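/- Let $M$ be a closed (compact, without boundary), connected smooth manifold of dimension $n$. Let $F$ be a Finsler metric on $M$, not necessarily reversible: a function $F:TM\to[0,\infty)$ that is $C^\infty$ on $TM\setminus\{0\}$, satisfies $F(x,\lambda y)=\lambda F(x,y)$ for all $\lambda>0$, and is such that the bilinear form $g_y(v,w)=\frac{\partial^2}{\partial s\,\partial t}\big|_{s=t=0}\tfrac12F^2(x,y+sv+tw)$ on $T_xM$ is positive definite for every $y\in T_xM\setminus\{0\}$. Let $\mathfrak m$ be a positive smooth measure on $M$ (in every local chart $d\mathfrak m=\sigma\,dx^1\cdots dx^n$ with $\sigma$ smooth and positive) with $\mathfrak m(M)=1$. For $x,z\in M$ let $d_F(x,z)=\inf_\gamma\int_0^1F(\gamma(t),\dot\gamma(t))\,dt$, the infimum being over all $C^1$ curves $\gamma:[0,1]\to M$ with $\gamma(0)=x$, $\gamma(1)=z$. Let $\mathrm{Lip}_1(M)$ be the set of functions $f:M\to\mathbb R$ with $f(z)-f(x)\le d_F(x,z)$ for all $x,z\in M$. For $0<\varepsilon<1$ let $$\mathrm{ObsDiam}_{\mathfrak m}(M;\varepsilon)=\sup_{f\in\mathrm{Lip}_1(M)}\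 \inf\{\operatorname{diam}(A): A\subset\mathbb R\text{ Borel},\ \mathfrak m(f^{-1}(A))\ge 1-\varepsilon\}.$$ With the dual metric $F^*(x,\xi)=\sup_{y\in T_xM\setminus\{0\}}\xi(y)/F(x,y)$ for $\xi\in T_x^*M$, let $$\lambda_1(M)=\inf_{u}\ \frac{\int_M F^*(du)^2\,d\mathfrak m}{\inf_{c\in\mathbb R}\int_M|u-c|^2\,d\mathfrak m},$$ the infimum being over all non-constant $u\in C^\infty(M)$ (for $n=0$ there is none, and $\lambda_1(M)=+\infty$). Then for every $0<\varepsilon<1$, $$\mathrm{ObsDiam}_{\mathfrak m}(M;\varepsilon)\le\frac{2\sqrt2}{\log2}\,\log\frac{2}{\varepsilon}\cdot\frac1{\sqrt{\lambda_1(M)}},$$ where all quantities are taken in $[0,+\infty]$ with $1/\sqrt0=+\infty$ and $1/\sqrt{+\infty}=0$. -/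

import Mathlib

open scoped Manifold ContDiff ENNReal
open MeasureTheory

noncomputable section

/-! ### Irreversible metric measure spaces -/

/-- `f` is `1`-Lipschitz for a (possibly asymmetric) distance `d`:
`f z - f x ≤ d x z` for all `x, z`. -/
def IsLipschitzOne {X : Type*} (d : X → X → ℝ≥0∞) (f : X → ℝ) : Prop :=
  ∀ x z : X, ENNReal.ofReal (f z - f x) ≤ d x z

/-- The diameter `sup_{x, z ∈ A} d x z` of a set for a (possibly asymmetric) distance `d`. -/
def asymDiam {X : Type*} (d : X → X → ℝ≥0∞) (A : Set X) : ℝ≥0∞ :=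
  ⨆ x ∈ A, ⨆ z ∈ A, d x z

/-- The partial diameter: the infimum of the diameters of the Borel sets
of measure at least `1 - κ`. -/
def parDiam {X : Type*} [MeasurableSpace X] (d : X → X → ℝ≥0∞) (μ : Measure X) (κ : ℝ) :
    ℝ≥0∞ :=
  ⨅ (A : Set X) (_ : MeasurableSet A) (_ : ENNReal.ofReal (1 - κ) ≤ μ A), asymDiam d A

/-- The observable diameter: the supremum over all `1`-Lipschitz functions `f` of the partial
diameter of the push-forward `f_* μ` on the real line with its usual distance. -/
def obsDiam {X : Type*} [MeasurableSpace X] (d : X → X → ℝ≥0∞) (μ : Measure X) (κ : ℝ) :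
    ℝ≥0∞ :=
  ⨆ (f : X → ℝ) (_ : IsLipschitzOne d f),
    parDiam (fun s t : ℝ => ENNReal.ofReal |s - t|) (μ.map f) κ

/-! ### Finsler manifolds -/

/-- The fundamental tensor of a fibre function `F` at a vector `y`, as a bilinear form:
`g_y(v, w) = ∂²/∂s∂t (F² / 2)(y + s v + t w)` at `s = t = 0`. -/
def fundamentalTensor {V : Type*} [AddCommGroup V] [Module ℝ V] (F : V → ℝ) (y v w : V) : ℝ :=
  deriv (fun s : ℝ => deriv (fun t : ℝ => F (y + s • v + t • w) ^ 2 / 2) 0) 0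

/-- A Finsler metric on an `n`-dimensional smooth manifold `M`: a nonnegative function on the
tangent bundle which is smooth off the zero section, positively `1`-homogeneous and strongly
convex. It is not assumed to be reversible. -/
structure FinslerMetric (n : ℕ) (M : Type*) [TopologicalSpace M]
    [ChartedSpace (EuclideanSpace ℝ (Fin n)) M] [IsManifold (𝓡 n) ∞ M] where
  /-- The value `F(x, y)` for `y ∈ T_x M`. -/
  toFun : (x : M) → TangentSpace (𝓡 n) x → ℝ
  nonneg : ∀ (x : M) (y : TangentSpace (𝓡 n) x), 0 ≤ toFun x y
  smooth : ContMDiffOn (𝓡 n).tangent 𝓘(ℝ, ℝ) ∞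
    (fun p : TangentBundle (𝓡 n) M => toFun p.1 p.2) {p | p.2 ≠ 0}
  homogeneous : ∀ (x : M) (y : TangentSpace (𝓡 n) x) (c : ℝ), 0 < c →
    toFun x (c • y) = c * toFun x y
  strongly_convex : ∀ (x : M) (y v : TangentSpace (𝓡 n) x), y ≠ 0 → v ≠ 0 →
    0 < fundamentalTensor (toFun x) y v v

namespace FinslerMetric

variable {n : ℕ} {M : Type*} [TopologicalSpace M]
  [ChartedSpace (EuclideanSpace ℝ (Fin n)) M] [IsManifold (𝓡 n) ∞ M]

/-- The length `∫₀¹ F(γ(t), γ'(t)) dt` of a curve. -/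
def length (F : FinslerMetric n M) (γ : ℝ → M) : ℝ≥0∞ :=
  ∫⁻ t in Set.Icc (0 : ℝ) 1, ENNReal.ofReal
    (F.toFun (γ t) (mfderivWithin 𝓘(ℝ, ℝ) (𝓡 n) γ (Set.Icc (0 : ℝ) 1) t (1 : ℝ)))

/-- The (in general asymmetric) distance from `x` to `z`: the infimum of the lengths of the `C¹`
curves `[0, 1] → M` from `x` to `z`. -/
def dist (F : FinslerMetric n M) (x z : M) : ℝ≥0∞ :=
  ⨅ (γ : ℝ → M) (_ : ContMDiffOn 𝓘(ℝ, ℝ) (𝓡 n) 1 γ (Set.Icc (0 : ℝ) 1))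
    (_ : γ 0 = x) (_ : γ 1 = z), F.length γ

/-- The dual metric `F*(x, ξ) = sup_{y ≠ 0} ξ(y) / F(x, y)`. Values are taken in `[0, ∞]`;
nothing is lost by truncating negative quotients to `0`, since `ξ(y) ≥ 0` or `ξ(-y) ≥ 0`. -/
def dual (F : FinslerMetric n M) (x : M) (ξ : TangentSpace (𝓡 n) x →L[ℝ] ℝ) : ℝ≥0∞ :=
  ⨆ (y : TangentSpace (𝓡 n) x) (_ : y ≠ 0), ENNReal.ofReal (ξ y / F.toFun x y)

/-- The energy `∫_M F*(du)² dm`. -/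
def energy [MeasurableSpace M] (F : FinslerMetric n M) (m : Measure M) (u : M → ℝ) : ℝ≥0∞ :=
  ∫⁻ x, F.dual x (mfderiv (𝓡 n) 𝓘(ℝ, ℝ) u x : TangentSpace (𝓡 n) x →L[ℝ] ℝ) ^ 2 ∂m

/-- The first eigenvalue: the infimum, over the non-constant smooth functions `u`, of
`∫ F*(du)² dm / inf_c ∫ |u - c|² dm`. -/
def firstEigenvalue [MeasurableSpace M] (F : FinslerMetric n M) (m : Measure M) : ℝ≥0∞ :=
  ⨅ (u : M → ℝ) (_ : ContMDiff (𝓡 n) 𝓘(ℝ, ℝ) ∞ u) (_ : ¬ ∃ c : ℝ, ∀ x, u x = c),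
    F.energy m u / ⨅ c : ℝ, ∫⁻ x, ENNReal.ofReal (|u x - c| ^ 2) ∂m

end FinslerMetric

/-- A positive smooth measure: in every chart of the atlas it is `σ(x) dx¹ ⋯ dxⁿ` with a smooth
positive density `σ`. (Transition maps being smooth, the same then holds in every chart of the
smooth structure.) -/
def IsPositiveSmoothMeasure (n : ℕ) {M : Type*} [TopologicalSpace M]
    [ChartedSpace (EuclideanSpace ℝ (Fin n)) M] [MeasurableSpace M] (m : Measure M) : Prop :=
  ∀ e ∈ atlas (EuclideanSpace ℝ (Fin n)) M, ∃ σ : EuclideanSpace ℝ (Fin n) → ℝ,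
    ContDiffOn ℝ ∞ σ e.target ∧ (∀ z ∈ e.target, 0 < σ z) ∧
    (m.restrict e.source).map e =
      (volume.restrict e.target).withDensity (fun z => ENNReal.ofReal (σ z))

end

/-! Poincaré's inequality, tested on truncations of a `1`-Lipschitz function, forces the tails of
its distribution to decay geometrically. Suppose `g` is smooth with `dg ≤ L F`, and let `A = {g ≤
r}`, `B = {r + s ≤ g}` have masses `p`, `q`. A nondecreasing clamp of `g` between the levels `r` and
`r + s` has energy at most `L² (1 - p - q)` and, in the limit of sharp clamps, variance at least `s²
p q / (p + q)`. So any real `0 < l ≤ λ₁` satisfies `l s² p q ≤ L² (1 - p - q) (p + q)`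
(`firstEigenvalue_mul_measure_le`). Take `s = L √(2 / l)`. If `p ≥ 1/2`, then `q ≤ p`, and the
inequality gives `2 q ≤ 1 - p`: moving up by `s` halves the upper tail, and symmetrically below.
From a median, `k` steps each way leave mass at most `2⁻ᵏ` outside an interval of length `2 k s`
(`exists_concentration_interval`). The least `k` with `2⁻ᵏ ≤ ε` is at most `log (2 / ε) / log 2`,
which yields the constant `2√2 / log 2`.

A `1`-Lipschitz `f` need not be smooth, so it is approximated uniformly by smooth `g` with `dg ≤ (1
+ δ) F` (`exists_smooth_approx`). In a small chart, `F` is within factors `1 ± κ` of one fixed fibre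
function `p`. Segments bound the increments of `f` by `(1 + κ) p`; convolution keeps such
translation-invariant bounds, and a partition of unity glues the local approximations. As `F` need
not be reversible, all these bounds are one-sided, which is why the clamp must be nondecreasing. -/

noncomputable section

open Filter Topology

namespace FinslerMetric

/-! ### Positivity of a Finsler metric and comparison with a frozen fibre -/

section Basic

variable {n : ℕ} {M : Type*} [TopologicalSpace M]
  [ChartedSpace (EuclideanSpace ℝ (Fin n)) M] [IsManifold (𝓡 n) ∞ M]

lemma apply_zero (F : FinslerMetric n M) (x : M) :
    F.toFun x (0 : TangentSpace (𝓡 n) x) = 0 := by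
  have h := F.homogeneous x 0 2 (by norm_num)
  rw [smul_zero] at h
  linarith

lemma apply_smul (F : FinslerMetric n M) (x : M) (y : TangentSpace (𝓡 n) x) {c : ℝ}
    (hc : 0 ≤ c) : F.toFun x (c • y) = c * F.toFun x y := by
  rcases hc.eq_or_lt with rfl | hc
  · rw [zero_smul, zero_mul, F.apply_zero]
  · exact F.homogeneous x y c hc

/-- Euler's identity `g_y(y, y) = F(y)²`. -/
lemma fundamentalTensor_self (F : FinslerMetric n M) (x : M) (y : TangentSpace (𝓡 n) x) :
    fundamentalTensor (F.toFun x) y y y = F.toFun x y ^ 2 := by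
  set a := F.toFun x y
  -- Homogeneity holds for positive factors only; near `s = t = 0` this is enough to compute both
  -- derivatives.
  have key : ∀ s t : ℝ, 0 < 1 + s + t →
      F.toFun x (y + s • y + t • y) ^ 2 / 2 = (1 + s + t) ^ 2 * (a ^ 2 / 2) := by
    intro s t hst
    have h : y + s • y + t • y = (1 + s + t) • y := by module
    rw [h, F.homogeneous x y _ hst]
    ring
  have inner : ∀ s : ℝ, -1 < s →
      deriv (fun t : ℝ => F.toFun x (y + s • y + t • y) ^ 2 / 2) 0 = (1 + s) * a ^ 2 := by
    intro s hs
    have hev : (fun t : ℝ => F.toFun x (y + s • y + t • y) ^ 2 / 2)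
        =ᶠ[𝓝 0] fun t => (1 + s + t) ^ 2 * (a ^ 2 / 2) := by
      filter_upwards [lt_mem_nhds (show -(1 + s) < 0 by linarith)] with t ht
      exact key s t (by linarith)
    rw [hev.deriv_eq]
    have hd := ((((hasDerivAt_id (0 : ℝ)).const_add (1 + s)).pow 2).mul_const (a ^ 2 / 2)).deriv
    simp only [id_eq] at hd
    refine Eq.trans ?_ (hd.trans ?_)
    · rfl
    · norm_num; ring
  have houter : (fun s : ℝ => deriv (fun t : ℝ => F.toFun x (y + s • y + t • y) ^ 2 / 2) 0)
      =ᶠ[𝓝 0] fun s => (1 + s) * a ^ 2 := by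
    filter_upwards [lt_mem_nhds (show (-1 : ℝ) < 0 by norm_num)] with s hs
    exact inner s hs
  rw [fundamentalTensor, houter.deriv_eq]
  have hd := (((hasDerivAt_id (0 : ℝ)).const_add 1).mul_const (a ^ 2)).deriv
  refine Eq.trans ?_ (hd.trans ?_)
  · rfl
  · simp

/-- By Euler's identity, strong convexity in the direction `y` itself reads `F(y)² > 0`. -/
lemma pos (F : FinslerMetric n M) (x : M) {y : TangentSpace (𝓡 n) x} (hy : y ≠ 0) :
    0 < F.toFun x y := by
  have h := F.strongly_convex x y y hy hy
  rw [fundamentalTensor_self] at h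
  exact (F.nonneg x y).lt_of_ne fun h0 => by rw [← h0] at h; norm_num at h

/-- Near a point, a Finsler metric read in the chart is comparable, with constants arbitrarily
close to `1`, to a fixed positively homogeneous function. -/
lemma exists_local_comparison (F : FinslerMetric n M) (x₀ : M) {δ : ℝ} (hδ : 0 < δ) :
    ∃ (p : EuclideanSpace ℝ (Fin n) → ℝ) (c C : ℝ), 0 < c ∧ 0 ≤ C ∧
      (∀ v, c * ‖v‖ ≤ p v) ∧ (∀ v, p v ≤ C * ‖v‖) ∧
      (∀ (r : ℝ) (v), 0 ≤ r → p (r • v) = r * p v) ∧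
      ∀ᶠ x in 𝓝 x₀, ∀ y : TangentSpace (𝓡 n) x,
        (1 - δ) * p ((trivializationAt (EuclideanSpace ℝ (Fin n)) (TangentSpace (𝓡 n))
          x₀).continuousLinearMapAt ℝ x y) ≤ F.toFun x y ∧
        F.toFun x y ≤ (1 + δ) * p ((trivializationAt (EuclideanSpace ℝ (Fin n))
          (TangentSpace (𝓡 n)) x₀).continuousLinearMapAt ℝ x y) := by
  set T := trivializationAt (EuclideanSpace ℝ (Fin n)) (TangentSpace (𝓡 n) : M → Type _) x₀
    with hT
  have hx₀ : x₀ ∈ T.baseSet := FiberBundle.mem_baseSet_trivializationAt' x₀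
  -- `G` is `F` in the coordinates of the trivialization; the comparison function is its value `G
  -- (x₀, ·)` at the centre.
  set G : M × EuclideanSpace ℝ (Fin n) → ℝ := fun q => F.toFun q.1 (T.symmL ℝ q.1 q.2) with hG
  have hGsmul : ∀ (x : M) (r : ℝ) (v), 0 ≤ r → G (x, r • v) = r * G (x, v) := by
    intro x r v hr
    simp only [hG, map_smul]
    exact F.apply_smul x _ hr
  have hne : ∀ x ∈ T.baseSet, ∀ v, v ≠ 0 → T.symmL ℝ x v ≠ 0 := by
    intro x hx v hv h0
    have := T.continuousLinearMapAt_symmL (R := ℝ) hx v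
    rw [h0, map_zero] at this
    exact hv this.symm
  have hGpos : ∀ x ∈ T.baseSet, ∀ v, v ≠ 0 → 0 < G (x, v) := fun x hx v hv =>
    F.pos x (hne x hx v hv)
  have hGcont : ∀ x ∈ T.baseSet, ∀ v, v ≠ 0 → ContinuousAt G (x, v) := by
    intro x hx v hv
    have hnhds : T.baseSet ×ˢ {v | v ≠ 0} ∈ 𝓝 (x, v) :=
      (T.open_baseSet.prod isOpen_ne).mem_nhds ⟨hx, hv⟩
    have hmem : ∀ q ∈ T.baseSet ×ˢ {v : EuclideanSpace ℝ (Fin n) | v ≠ 0},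
        T.toOpenPartialHomeomorph.symm q = ⟨q.1, T.symmL ℝ q.1 q.2⟩ := by
      intro q hq
      rw [T.symmL_apply hq.1]
      exact (T.mk_symm hq.1 q.2).symm
    have h1 := F.smooth.continuousOn ⟨x, T.symmL ℝ x v⟩ (hne x hx v hv)
    have h2 : ContinuousAt T.toOpenPartialHomeomorph.symm (x, v) :=
      T.toOpenPartialHomeomorph.symm.continuousAt (T.mem_target.2 hx)
    have h3 : Tendsto T.toOpenPartialHomeomorph.symm (𝓝 (x, v))
        (𝓝[{q : TangentBundle (𝓡 n) M | q.2 ≠ 0}] ⟨x, T.symmL ℝ x v⟩) := by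
      refine tendsto_nhdsWithin_iff.2 ⟨?_, ?_⟩
      · rw [← hmem (x, v) ⟨hx, hv⟩]
        exact h2
      · filter_upwards [hnhds] with q hq
        rw [hmem q hq]
        exact hne q.1 hq.1 q.2 hq.2
    refine (h1.tendsto.comp h3).congr' ?_
    filter_upwards [hnhds] with q hq
    simp only [Function.comp_apply, hG]
    rw [hmem q hq]
  set S := Metric.sphere (0 : EuclideanSpace ℝ (Fin n)) 1
  have hS : IsCompact S := isCompact_sphere _ _
  have hS0 : ∀ v ∈ S, v ≠ 0 := fun v hv => ne_zero_of_mem_unit_sphere ⟨v, hv⟩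
  have hpc : ContinuousOn (fun v => G (x₀, v)) S := fun v hv =>
    ((hGcont x₀ hx₀ v (hS0 v hv)).comp
      (f := fun v => (x₀, v)) (by fun_prop)).continuousWithinAt
  obtain ⟨C, hC⟩ := hS.exists_bound_of_continuousOn hpc
  obtain ⟨c, hc⟩ := hS.exists_bound_of_continuousOn
    (hpc.inv₀ fun v hv => (hGpos x₀ hx₀ v (hS0 v hv)).ne')
  have hp0 : ∀ x, G (x, 0) = 0 := fun x => by
    have := hGsmul x 0 0 le_rfl
    rwa [zero_smul, zero_mul] at this
  have hunit : ∀ v : EuclideanSpace ℝ (Fin n), v ≠ 0 → ‖v‖⁻¹ • v ∈ S := fun v hv => by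
    simp [S, norm_smul, hv]
  have hscale : ∀ (x) (v : EuclideanSpace ℝ (Fin n)), v ≠ 0 →
      G (x, v) = ‖v‖ * G (x, ‖v‖⁻¹ • v) := fun x v hv => by
    rw [← hGsmul x _ _ (norm_nonneg v), smul_smul, mul_inv_cancel₀ (norm_ne_zero_iff.2 hv),
      one_smul]
  -- Compactness of the unit sphere makes the neighbourhood of `x₀` uniform in the direction;
  -- homogeneity later extends this to all vectors.
  have hev : ∀ᶠ x in 𝓝 x₀, ∀ v ∈ S,
      (1 - δ) * G (x₀, v) < G (x, v) ∧ G (x, v) < (1 + δ) * G (x₀, v) := by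
    refine hS.eventually_forall_of_forall_eventually fun v hv => ?_
    have hcv := hGcont x₀ hx₀ v (hS0 v hv)
    have hcv' : ContinuousAt (fun q : M × EuclideanSpace ℝ (Fin n) => G (x₀, q.2)) (x₀, v) :=
      hcv.comp_of_eq (f := fun q : M × EuclideanSpace ℝ (Fin n) => (x₀, q.2)) (by fun_prop) rfl
    have hpos := hGpos x₀ hx₀ v (hS0 v hv)
    exact ((continuousAt_const.mul hcv').eventually_lt hcv (by simp only [Pi.mul_apply]; nlinarith)).and
      (hcv.eventually_lt (continuousAt_const.mul hcv')
        (by nlinarith))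
  -- The maxima guarantee the required signs even when the sphere is empty (`n = 0`) and the
  -- compactness bounds say nothing.
  refine ⟨fun v => G (x₀, v), (max c 1)⁻¹, max C 0, by positivity, le_max_right _ _, ?_, ?_,
    fun r v hr => hGsmul x₀ r v hr, ?_⟩
  · intro v
    by_cases hv : v = 0
    · simp [hv, hp0]
    have h := hc _ (hunit v hv)
    have hpos := hGpos x₀ hx₀ _ (hS0 _ (hunit v hv))
    rw [Pi.inv_apply, Real.norm_eq_abs, abs_inv, abs_of_pos hpos] at h
    have h' : (max c 1)⁻¹ ≤ G (x₀, ‖v‖⁻¹ • v) :=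
      inv_le_of_inv_le₀ hpos (h.trans (le_max_left _ _))
    show _ ≤ G (x₀, v)
    rw [hscale x₀ v hv, mul_comm]
    gcongr
  · intro v
    by_cases hv : v = 0
    · simp [hv, hp0]
    have h := (le_abs_self _).trans (hC _ (hunit v hv))
    show G (x₀, v) ≤ _
    rw [hscale x₀ v hv, mul_comm]
    gcongr
    exact h.trans (le_max_left _ _)
  · filter_upwards [hev, T.open_baseSet.mem_nhds hx₀] with x hx hxT y
    have hFy : F.toFun x y = G (x, T.continuousLinearMapAt ℝ x y) := by
      simp only [hG]
      rw [T.symmL_continuousLinearMapAt (R := ℝ) hxT]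
    rw [hFy]
    set v := T.continuousLinearMapAt ℝ x y
    by_cases hv : v = 0
    · simp [hv, hp0]
    obtain ⟨h1, h2⟩ := hx _ (hunit v hv)
    rw [hscale x v hv, hscale x₀ v hv]
    have := norm_nonneg v
    constructor <;> nlinarith

end Basic

end FinslerMetric

namespace FinslerMetric

/-! ### Upper bound for the distance along chart segments -/

section Distance

variable {n : ℕ} {M : Type*} [TopologicalSpace M]
  [ChartedSpace (EuclideanSpace ℝ (Fin n)) M] [IsManifold (𝓡 n) ∞ M]

/-- The distance between the endpoints of a segment in a chart is at most any bound for `F` along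
the segment. -/
lemma dist_le_of_segment (F : FinslerMetric n M) (x₀ : M) {a b : EuclideanSpace ℝ (Fin n)} {L : ℝ}
    (hseg : segment ℝ a b ⊆ (extChartAt (𝓡 n) x₀).target)
    (hF : ∀ z ∈ segment ℝ a b,
      ∀ y : TangentSpace (𝓡 n) ((extChartAt (𝓡 n) x₀).symm z),
        (trivializationAt (EuclideanSpace ℝ (Fin n)) (TangentSpace (𝓡 n)) x₀).continuousLinearMapAt
          ℝ _ y = b - a → F.toFun _ y ≤ L) :
    F.dist ((extChartAt (𝓡 n) x₀).symm a) ((extChartAt (𝓡 n) x₀).symm b) ≤ ENNReal.ofReal L := by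
  set e := extChartAt (𝓡 n) x₀ with he
  set l : ℝ → EuclideanSpace ℝ (Fin n) := fun t => a + t • (b - a) with hl
  set I := Set.Icc (0 : ℝ) 1
  have hlmem : ∀ t ∈ I, l t ∈ segment ℝ a b := fun t ht => by
    rw [segment_eq_image']
    exact ⟨t, ht, rfl⟩
  have hld : ∀ t, HasDerivAt l (b - a) t := fun t => by
    simpa only [one_smul, id] using ((hasDerivAt_id t).smul_const (b - a)).const_add a
  have hlsmooth : ContMDiff 𝓘(ℝ, ℝ) (𝓡 n) 1 l := by
    rw [contMDiff_iff_contDiff]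
    fun_prop
  have hγ : ContMDiffOn 𝓘(ℝ, ℝ) (𝓡 n) 1 (fun t => e.symm (l t)) I :=
    (contMDiffOn_extChartAt_symm x₀).comp hlsmooth.contMDiffOn
      (fun t ht => hseg (hlmem t ht))
  have hbound : ∀ t ∈ I, F.toFun (e.symm (l t))
      (mfderivWithin 𝓘(ℝ, ℝ) (𝓡 n) (fun t => e.symm (l t)) I t (1 : ℝ)) ≤ L := by
    intro t ht
    refine hF (l t) (hlmem t ht) _ ?_
    have hsrc : e.symm (l t) ∈ e.source := e.map_target (hseg (hlmem t ht))
    have hsrc' : e.symm (l t) ∈ (chartAt (EuclideanSpace ℝ (Fin n)) x₀).source := by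
      rwa [he, extChartAt_source] at hsrc
    -- The trivialization acts as the differential of the chart. By the chain rule it sends the
    -- velocity of the curve to that of its image in the chart, a segment with velocity `b - a`.
    rw [TangentBundle.continuousLinearMapAt_trivializationAt hsrc']
    have hu : UniqueMDiffWithinAt 𝓘(ℝ, ℝ) I t :=
      (uniqueDiffOn_Icc zero_lt_one t ht).uniqueMDiffWithinAt
    have hcomp := mfderiv_comp_mfderivWithin (I := 𝓘(ℝ, ℝ)) (I' := 𝓡 n) (I'' := 𝓡 n)
      (g := e) (f := fun t => e.symm (l t)) (s := I) t
      (mdifferentiableAt_extChartAt hsrc')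
      ((hγ t ht).mdifferentiableWithinAt one_ne_zero) hu
    have heq : mfderivWithin 𝓘(ℝ, ℝ) (𝓡 n) (e ∘ fun t => e.symm (l t)) I t
        = mfderivWithin 𝓘(ℝ, ℝ) (𝓡 n) l I t := by
      refine mfderivWithin_congr (fun s hs => ?_) ?_
      · exact e.right_inv (hseg (hlmem s hs))
      · exact e.right_inv (hseg (hlmem t ht))
    refine (DFunLike.congr_fun hcomp (1 : ℝ)).symm.trans ((DFunLike.congr_fun heq (1 : ℝ)).trans ?_)
    have hfd : fderivWithin ℝ l I t = ContinuousLinearMap.toSpanSingleton ℝ (b - a) :=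
      (hld t).hasFDerivAt.hasFDerivWithinAt.fderivWithin (uniqueDiffOn_Icc zero_lt_one t ht)
    rw [mfderivWithin_eq_fderivWithin, hfd]
    exact one_smul ℝ (b - a)
  have hle : F.dist (e.symm a) (e.symm b) ≤ F.length (fun t => e.symm (l t)) := by
    rw [FinslerMetric.dist]
    exact iInf₂_le_of_le _ hγ (iInf₂_le_of_le (by simp [hl]) (by simp [hl]) le_rfl)
  refine hle.trans ?_
  calc F.length (fun t => e.symm (l t)) ≤ ∫⁻ _ in I, ENNReal.ofReal L := by
        refine setLIntegral_mono' measurableSet_Icc fun t ht => ?_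
        exact ENNReal.ofReal_le_ofReal (hbound t ht)
    _ = ENNReal.ofReal L := by simp [I]

end Distance

end FinslerMetric

/-! ### One-sided increment bounds: differentiation and mollification -/

section Euclidean

variable {E : Type*} [NormedAddCommGroup E] [NormedSpace ℝ E]

/-- A one-sided bound for the increments from a point by a positively homogeneous function is
inherited by the derivative at that point. -/
lemma fderiv_le_of_sub_le {g p : E → ℝ} {a : E} (hg : DifferentiableAt ℝ g a)
    (h : ∀ᶠ b in 𝓝 a, g b - g a ≤ p (b - a))
    (hp : ∀ (r : ℝ) (v), 0 ≤ r → p (r • v) = r * p v) (v : E) : fderiv ℝ g a v ≤ p v := by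
  have hlim := hg.hasFDerivAt.hasLineDerivAt v
  -- Only slopes from the right are usable, since `p` is homogeneous for nonnegative factors only.
  have hd : Tendsto (fun t : ℝ => t⁻¹ • (g (a + t • v) - g a)) (𝓝[>] 0) (𝓝 (fderiv ℝ g a v)) :=
    hlim.tendsto_slope_zero_right
  have hev : ∀ᶠ t : ℝ in 𝓝[>] 0, g (a + t • v) - g a ≤ p (a + t • v - a) := by
    have hc : Tendsto (fun t : ℝ => a + t • v) (𝓝[>] 0) (𝓝 a) := by
      have : Continuous fun t : ℝ => a + t • v := by fun_prop
      simpa using (this.tendsto 0).mono_left nhdsWithin_le_nhds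
    exact hc.eventually h
  refine le_of_tendsto hd ?_
  filter_upwards [hev, self_mem_nhdsWithin] with t ht ht0
  have ht0 : 0 < t := ht0
  rw [add_sub_cancel_left, hp t v ht0.le] at ht
  rw [smul_eq_mul, inv_mul_le_iff₀ ht0]
  exact ht

/-- Mollification preserves one-sided bounds for the increments of a Lipschitz function. -/
lemma LipschitzWith.exists_contDiff_sub_le [FiniteDimensional ℝ E] {h p : E → ℝ} {K : NNReal}
    (hh : LipschitzWith K h) {a₀ : E} {R : ℝ} (hR : 0 < R)
    (hp : ∀ a ∈ Metric.ball a₀ R, ∀ b ∈ Metric.ball a₀ R, h b - h a ≤ p (b - a))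
    {η : ℝ} (hη : 0 < η) :
    ∃ g : E → ℝ, ContDiff ℝ ∞ g ∧ (∀ a, |g a - h a| ≤ η) ∧
      ∀ a ∈ Metric.ball a₀ (R / 2), ∀ b ∈ Metric.ball a₀ (R / 2), g b - g a ≤ p (b - a) := by
  borelize E
  set μ : Measure E := Measure.addHaar
  -- The first bound keeps translates of the half ball inside the full ball; the second makes the
  -- error at most `K r ≤ η`, with `+ 1` covering `K = 0`.
  set r := min (R / 2) (η / (K + 1)) with hr
  have hr0 : 0 < r := by positivity
  let φ : ContDiffBump (0 : E) := ⟨r / 2, r, half_pos hr0, half_lt_self hr0⟩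
  refine ⟨convolution (φ.normed μ) h (ContinuousLinearMap.lsmul ℝ ℝ) μ, ?_, ?_, ?_⟩
  · exact φ.hasCompactSupport_normed.contDiff_convolution_left _ φ.contDiff_normed
      hh.continuous.locallyIntegrable
  · intro a
    rw [← Real.dist_eq]
    refine φ.dist_normed_convolution_le hh.continuous.aestronglyMeasurable fun x hx => ?_
    calc dist (h x) (h a) ≤ K * dist x a := hh.dist_le_mul x a
      _ ≤ (K + 1) * (η / (K + 1)) := by
          have : dist x a ≤ r := (Metric.mem_ball.1 hx).le
          gcongr
          · linarith
          · exact this.trans (min_le_right _ _)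
      _ = η := by field_simp
  · intro a ha b hb
    have hint : ∀ c : E, Integrable (fun t => φ.normed μ t * h (c - t)) μ := fun c =>
      ((φ.continuous_normed).mul (hh.continuous.comp (by fun_prop))).integrable_of_hasCompactSupport
        φ.hasCompactSupport_normed.mul_right
    have hconv : ∀ c : E, convolution (φ.normed μ) h (ContinuousLinearMap.lsmul ℝ ℝ) μ c
        = ∫ t, φ.normed μ t * h (c - t) ∂μ := fun c => rfl
    rw [hconv, hconv, ← integral_sub (hint b) (hint a)]
    -- The increment of the mollification is an average of the increments `h (b - t) - h (a - t)`,
    -- all taken over the same vector `b - a`.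
    calc ∫ t, (φ.normed μ t * h (b - t) - φ.normed μ t * h (a - t)) ∂μ
        ≤ ∫ t, φ.normed μ t * p (b - a) ∂μ := by
          refine integral_mono ((hint b).sub (hint a)) (φ.integrable_normed.mul_const _) fun t => ?_
          beta_reduce
          rw [← mul_sub]
          by_cases ht : t ∈ Metric.ball (0 : E) r
          · refine mul_le_mul_of_nonneg_left ?_ (φ.nonneg_normed t)
            have hmem : ∀ c ∈ Metric.ball a₀ (R / 2), c - t ∈ Metric.ball a₀ R := fun c hc => by
              rw [mem_ball_iff_norm] at hc ⊢
              rw [mem_ball_zero_iff] at ht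
              calc ‖c - t - a₀‖ = ‖(c - a₀) - t‖ := by congr 1; abel
                _ ≤ ‖c - a₀‖ + ‖t‖ := _root_.norm_sub_le _ _
                _ < R / 2 + R / 2 := add_lt_add hc (ht.trans_le (min_le_left _ _))
                _ = R := add_halves R
            have := hp _ (hmem a ha) _ (hmem b hb)
            rwa [sub_sub_sub_cancel_right] at this
          · have h0 : φ.normed μ t = 0 := by
              rw [← Function.notMem_support, φ.support_normed_eq]
              exact ht
            simp [h0]
      _ = p (b - a) := by rw [integral_mul_const, φ.integral_normed, one_mul]

end Euclidean

/-! ### Differentials of real functions -/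

section Differential

variable {n : ℕ} {M : Type*} [TopologicalSpace M] [ChartedSpace (EuclideanSpace ℝ (Fin n)) M]

/-- The differential of a real function, as a linear form on the tangent space. -/
def differential (n : ℕ) {M : Type*} [TopologicalSpace M]
    [ChartedSpace (EuclideanSpace ℝ (Fin n)) M] (u : M → ℝ) (x : M) :
    TangentSpace (𝓡 n) x →L[ℝ] ℝ :=
  mfderiv (𝓡 n) 𝓘(ℝ, ℝ) u x

lemma HasMFDerivAt.differential_eq {u : M → ℝ} {x : M} {u' : TangentSpace (𝓡 n) x →L[ℝ] ℝ}
    (h : HasMFDerivAt (𝓡 n) 𝓘(ℝ, ℝ) u x u') : differential n u x = u' :=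
  h.mfderiv

lemma MDifferentiableAt.hasMFDerivAt_differential {u : M → ℝ} {x : M}
    (h : MDifferentiableAt (𝓡 n) 𝓘(ℝ, ℝ) u x) :
    HasMFDerivAt (𝓡 n) 𝓘(ℝ, ℝ) u x (differential n u x) :=
  h.hasMFDerivAt

/-- The differential of a function given in a chart. -/
lemma differential_comp_extChartAt [IsManifold (𝓡 n) ∞ M] {g : EuclideanSpace ℝ (Fin n) → ℝ}
    {x₀ x : M} (hx : x ∈ (chartAt (EuclideanSpace ℝ (Fin n)) x₀).source)
    (hg : DifferentiableAt ℝ g (extChartAt (𝓡 n) x₀ x)) (y : TangentSpace (𝓡 n) x) :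
    differential n (g ∘ extChartAt (𝓡 n) x₀) x y = fderiv ℝ g (extChartAt (𝓡 n) x₀ x)
      ((trivializationAt (EuclideanSpace ℝ (Fin n)) (TangentSpace (𝓡 n))
        x₀).continuousLinearMapAt ℝ x y) := by
  rw [TangentBundle.continuousLinearMapAt_trivializationAt hx]
  have h := HasMFDerivAt.comp x hg.hasFDerivAt.hasMFDerivAt
    (mdifferentiableAt_extChartAt (I := 𝓡 n) hx).hasMFDerivAt
  rw [h.differential_eq]
  rfl

lemma differential_comp_real {φ : ℝ → ℝ} {u : M → ℝ} {x : M}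
    (hφ : DifferentiableAt ℝ φ (u x)) (hu : MDifferentiableAt (𝓡 n) 𝓘(ℝ, ℝ) u x) :
    differential n (φ ∘ u) x = deriv φ (u x) • differential n u x := by
  have h := HasMFDerivAt.comp x hφ.hasFDerivAt.hasMFDerivAt hu.hasMFDerivAt
  rw [h.differential_eq]
  ext y
  exact fderiv_eq_smul_deriv (f := φ) (x := u x) (differential n u x y) |>.trans (mul_comm _ _)

end Differential

namespace FinslerMetric

/-! ### Local smoothing of Lipschitz functions -/

section Smoothing

variable {n : ℕ} {M : Type*} [TopologicalSpace M]
  [ChartedSpace (EuclideanSpace ℝ (Fin n)) M] [IsManifold (𝓡 n) ∞ M]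

/-- Locally, a `1`-Lipschitz function for the Finsler distance is a uniform limit of smooth
functions with almost the same Lipschitz bound. -/
lemma exists_local_smooth_approx (F : FinslerMetric n M) {f : M → ℝ} (hf : IsLipschitzOne F.dist f)
    (x₀ : M) {δ : ℝ} (hδ : 0 < δ) :
    ∃ U : Set M, IsOpen U ∧ x₀ ∈ U ∧ ContinuousOn f U ∧ ∀ η : ℝ, 0 < η →
      ∃ g : M → ℝ, ContMDiffOn (𝓡 n) 𝓘(ℝ, ℝ) ∞ g U ∧ (∀ x ∈ U, |g x - f x| ≤ η) ∧
        ∀ x ∈ U, ∀ y : TangentSpace (𝓡 n) x,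
          differential n g x y ≤ (1 + δ) * F.toFun x y := by
  -- This solves `(1 + κ) / (1 - κ) = 1 + δ`: one comparison bounds the increments by `p`, the other
  -- returns from `p` to `F`.
  set κ := δ / (2 + δ) with hκ
  have hκ0 : 0 < κ := by positivity
  have hκ1 : κ < 1 := by rw [hκ, div_lt_one (by positivity)]; linarith
  have hκδ : 1 + κ = (1 + δ) * (1 - κ) := by rw [hκ]; field_simp; ring
  obtain ⟨p, c, C, hc, hC, hcp, hpC, hps, hcomp⟩ := F.exists_local_comparison x₀ hκ0
  set e := extChartAt (𝓡 n) x₀ with he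
  set a₀ := e x₀ with ha₀
  have hev : ∀ᶠ a in 𝓝 a₀, a ∈ e.target ∧ ∀ y : TangentSpace (𝓡 n) (e.symm a),
        (1 - κ) * p ((trivializationAt (EuclideanSpace ℝ (Fin n)) (TangentSpace (𝓡 n))
          x₀).continuousLinearMapAt ℝ _ y) ≤ F.toFun _ y ∧
        F.toFun _ y ≤ (1 + κ) * p ((trivializationAt (EuclideanSpace ℝ (Fin n))
          (TangentSpace (𝓡 n)) x₀).continuousLinearMapAt ℝ _ y) := by
    have hcs : Tendsto e.symm (𝓝 a₀) (𝓝 x₀) := by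
      have := continuousAt_extChartAt_symm (I := 𝓡 n) x₀
      rwa [ContinuousAt, extChartAt_to_inv] at this
    exact (show ∀ᶠ a in 𝓝 a₀, a ∈ e.target from extChartAt_target_mem_nhds x₀).and
      (hcs.eventually hcomp)
  obtain ⟨R, hR, hball⟩ := Metric.eventually_nhds_iff_ball.1 hev
  set h : EuclideanSpace ℝ (Fin n) → ℝ := fun a => f (e.symm a) with hh
  have hincr : ∀ a ∈ Metric.ball a₀ R, ∀ b ∈ Metric.ball a₀ R,
      h b - h a ≤ (1 + κ) * p (b - a) := by
    intro a ha b hb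
    have hseg := (convex_ball a₀ R).segment_subset ha hb
    have hp0 : 0 ≤ p (b - a) := le_trans (by positivity) (hcp (b - a))
    have hd := F.dist_le_of_segment x₀ (L := (1 + κ) * p (b - a))
      (fun z hz => (hball z (hseg hz)).1)
      (fun z hz y hy => by rw [← hy]; exact ((hball z (hseg hz)).2 y).2)
    exact (ENNReal.ofReal_le_ofReal_iff (by positivity)).1 ((hf _ _).trans hd)
  have hLip : LipschitzOnWith (Real.toNNReal ((1 + κ) * C)) h (Metric.ball a₀ R) := by
    refine LipschitzOnWith.of_le_add_mul _ fun x hx y hy => ?_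
    have h1 := hincr y hy x hx
    have h2 := hpC (x - y)
    rw [Real.coe_toNNReal _ (by positivity), dist_eq_norm]
    nlinarith
  -- Convolution needs a function on the whole space; the values of the extension outside the ball
  -- do not affect the increment bound.
  obtain ⟨h', hh', hEq⟩ := hLip.extend_real
  set U : Set M := e.source ∩ e ⁻¹' Metric.ball a₀ (R / 2) with hU
  have hUmem : ∀ x ∈ U, e x ∈ Metric.ball a₀ R := fun x hx =>
    Metric.ball_subset_ball (half_le_self hR.le) hx.2
  have hfh : ∀ x ∈ U, f x = h' (e x) := fun x hx => by
    rw [← hEq (hUmem x hx), hh]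
    simp only [e.left_inv hx.1]
  refine ⟨U, isOpen_extChartAt_preimage' x₀ Metric.isOpen_ball,
    ⟨mem_extChartAt_source x₀, Metric.mem_ball_self (half_pos hR)⟩, ?_, fun η hη => ?_⟩
  · have : ContinuousOn (h' ∘ e) U :=
      hh'.continuous.comp_continuousOn ((continuousOn_extChartAt x₀).mono fun x hx => hx.1)
    exact this.congr hfh
  · obtain ⟨g, hg, hgη, hgp⟩ := hh'.exists_contDiff_sub_le hR
      (p := fun v => (1 + κ) * p v) (fun a ha b hb => by
        rw [← hEq ha, ← hEq hb]
        exact hincr a ha b hb) hη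
    refine ⟨g ∘ e, ?_, fun x hx => ?_, fun x hx y => ?_⟩
    · exact hg.contMDiff.comp_contMDiffOn ((contMDiffOn_extChartAt (I := 𝓡 n)).mono fun x hx => by
        simpa [he] using hx.1)
    · rw [hfh x hx]
      exact hgη _
    · have hsrc : x ∈ (chartAt (EuclideanSpace ℝ (Fin n)) x₀).source := by
        simpa [he] using hx.1
      have hgd : DifferentiableAt ℝ g (e x) := hg.differentiable (by simp) _
      rw [differential_comp_extChartAt hsrc hgd]
      have h1 : ∀ᶠ b in 𝓝 (e x), g b - g (e x) ≤ (1 + κ) * p (b - e x) := by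
        filter_upwards [Metric.isOpen_ball.mem_nhds hx.2] with b hb
        exact hgp _ hx.2 b hb
      refine (fderiv_le_of_sub_le hgd (p := fun v => (1 + κ) * p v) h1
        (fun r v hr => by rw [hps r v hr]; ring) _).trans ?_
      have h2 := (hball (e x) (hUmem x hx)).2
      rw [e.left_inv hx.1] at h2
      have h3 := (h2 y).1
      rw [hκδ, mul_assoc]
      gcongr

end Smoothing

end FinslerMetric

section DifferentialSum

variable {n : ℕ} {M : Type*} [TopologicalSpace M] [ChartedSpace (EuclideanSpace ℝ (Fin n)) M]

lemma HasMFDerivAt.sum_real {ι : Type*} (s : Finset ι) {u : ι → M → ℝ} {x : M}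
    {u' : ι → TangentSpace (𝓡 n) x →L[ℝ] ℝ}
    (h : ∀ i ∈ s, HasMFDerivAt (𝓡 n) 𝓘(ℝ, ℝ) (u i) x (u' i)) :
    HasMFDerivAt (𝓡 n) 𝓘(ℝ, ℝ) (fun z => ∑ i ∈ s, u i z) x (∑ i ∈ s, u' i) := by
  classical
  induction s using Finset.induction_on with
  | empty => simpa using! hasMFDerivAt_const (I := 𝓡 n) (I' := 𝓘(ℝ, ℝ)) (0 : ℝ) x
  | insert i s hi ih =>
    have h1 := (h i (Finset.mem_insert_self i s)).add
      (ih fun j hj => h j (Finset.mem_insert_of_mem hj))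
    have hu : (fun z => ∑ j ∈ insert i s, u j z) = u i + fun z => ∑ j ∈ s, u j z := by
      ext z
      exact Finset.sum_insert hi
    rw [hu]
    exact h1.congr_mfderiv (Finset.sum_insert (f := u') hi).symm

end DifferentialSum

namespace FinslerMetric

/-! ### Global smoothing by a partition of unity -/

section Approximation

variable {n : ℕ} {M : Type*} [TopologicalSpace M]
  [ChartedSpace (EuclideanSpace ℝ (Fin n)) M] [IsManifold (𝓡 n) ∞ M]

/-- In a chart the derivative is continuous, hence locally bounded, while `F` dominates a multiple
of the Euclidean norm. It serves to bound the differentials of the cutoffs in the partition of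
unity. -/
lemma eventually_abs_differential_le (F : FinslerMetric n M) {u : M → ℝ}
    (hu : ContMDiff (𝓡 n) 𝓘(ℝ, ℝ) ∞ u) (x₀ : M) :
    ∃ C : ℝ, 0 ≤ C ∧ ∀ᶠ x in 𝓝 x₀, ∀ y : TangentSpace (𝓡 n) x,
      |differential n u x y| ≤ C * F.toFun x y := by
  obtain ⟨p, c, -, hc, -, hcp, -, -, hcomp⟩ := F.exists_local_comparison x₀ one_half_pos
  set e := extChartAt (𝓡 n) x₀ with he
  set w : EuclideanSpace ℝ (Fin n) → ℝ := u ∘ e.symm with hw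
  have hopen : IsOpen e.target := isOpen_extChartAt_target x₀
  have hwd : ContDiffOn ℝ ∞ w e.target :=
    contMDiffOn_iff_contDiffOn.1 (hu.comp_contMDiffOn (contMDiffOn_extChartAt_symm x₀))
  have hfc : ContinuousOn (fderiv ℝ w) e.target :=
    hwd.continuousOn_fderiv_of_isOpen hopen (by simp)
  have hmem : e x₀ ∈ e.target := mem_extChartAt_target x₀
  have hbd : ∀ᶠ a in 𝓝 (e x₀), ‖fderiv ℝ w a‖ < ‖fderiv ℝ w (e x₀)‖ + 1 :=
    ((hfc.continuousAt (hopen.mem_nhds hmem)).norm).eventually_lt continuousAt_const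
      (lt_add_one _)
  set B := ‖fderiv ℝ w (e x₀)‖ + 1
  refine ⟨2 * B / c, by positivity, ?_⟩
  filter_upwards [hcomp, (continuousAt_extChartAt (I := 𝓡 n) x₀).eventually hbd,
    extChartAt_source_mem_nhds (I := 𝓡 n) x₀] with x hx hBx hsrc y
  have hsrc' : x ∈ (chartAt (EuclideanSpace ℝ (Fin n)) x₀).source := by
    simpa using hsrc
  have heq : u =ᶠ[𝓝 x] w ∘ e := by
    filter_upwards [extChartAt_source_mem_nhds' (I := 𝓡 n) hsrc] with z hz
    simp only [hw, Function.comp_apply, he]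
    rw [(extChartAt (𝓡 n) x₀).left_inv hz]
  have hwx : DifferentiableAt ℝ w (e x) :=
    (hwd.differentiableOn (by simp)).differentiableAt (hopen.mem_nhds (e.map_source hsrc))
  have h1 : differential n u x y = differential n (w ∘ e) x y :=
    DFunLike.congr_fun (heq.mfderiv_eq (I := 𝓡 n) (I' := 𝓘(ℝ, ℝ))) y
  rw [h1, differential_comp_extChartAt hsrc' hwx]
  obtain ⟨h2, -⟩ := hx y
  set v := (trivializationAt (EuclideanSpace ℝ (Fin n)) (TangentSpace (𝓡 n))
        x₀).continuousLinearMapAt ℝ x y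
  calc |fderiv ℝ w (e x) v| ≤ ‖fderiv ℝ w (e x)‖ * ‖v‖ := (fderiv ℝ w (e x)).le_opNorm v
    _ ≤ B * ‖v‖ := by gcongr
    _ = B / c * (c * ‖v‖) := by field_simp
    _ ≤ B / c * (2 * F.toFun x y) := by
        exact mul_le_mul_of_nonneg_left (by linarith [hcp v]) (by positivity)
    _ = 2 * B / c * F.toFun x y := by ring

/-- On a compact manifold the differential of a smooth function is bounded. -/
lemma exists_abs_differential_le [CompactSpace M] (F : FinslerMetric n M) {u : M → ℝ}
    (hu : ContMDiff (𝓡 n) 𝓘(ℝ, ℝ) ∞ u) :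
    ∃ C : ℝ, 0 ≤ C ∧ ∀ (x : M) (y : TangentSpace (𝓡 n) x),
      |differential n u x y| ≤ C * F.toFun x y := by
  have := isCompact_univ.induction_on (X := M)
    (p := fun s => ∃ C : ℝ, 0 ≤ C ∧ ∀ x ∈ s, ∀ y : TangentSpace (𝓡 n) x,
      |differential n u x y| ≤ C * F.toFun x y)
    ⟨0, le_rfl, by simp⟩
    (fun s t hst ⟨C, hC, h⟩ => ⟨C, hC, fun x hx => h x (hst hx)⟩)
    (fun s t ⟨C, hC, h⟩ ⟨D, hD, h'⟩ => ⟨max C D, le_max_of_le_left hC, fun x hx y => by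
      have := F.nonneg x y
      rcases hx with hx | hx
      · exact (h x hx y).trans (by gcongr; exact le_max_left _ _)
      · exact (h' x hx y).trans (by gcongr; exact le_max_right _ _)⟩)
    (fun x _ => by
      obtain ⟨C, hC, h⟩ := F.eventually_abs_differential_le hu x
      exact ⟨_, mem_nhdsWithin_of_mem_nhds h, C, hC, fun z hz => hz⟩)
  obtain ⟨C, hC, h⟩ := this
  exact ⟨C, hC, fun x => h x trivial⟩

lemma continuous_of_isLipschitzOne (F : FinslerMetric n M) {f : M → ℝ}
    (hf : IsLipschitzOne F.dist f) : Continuous f :=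
  continuous_iff_continuousAt.2 fun x => by
    obtain ⟨U, hU, hxU, hc, -⟩ := F.exists_local_smooth_approx hf x one_pos
    exact hc.continuousAt (hU.mem_nhds hxU)

/-- On a compact manifold, a `1`-Lipschitz function for the Finsler distance is a uniform limit of
smooth functions with almost the same Lipschitz bound. -/
theorem exists_smooth_approx [T2Space M] [CompactSpace M] (F : FinslerMetric n M) {f : M → ℝ}
    (hf : IsLipschitzOne F.dist f) {δ : ℝ} (hδ : 0 < δ) :
    ∃ g : M → ℝ, ContMDiff (𝓡 n) 𝓘(ℝ, ℝ) ∞ g ∧ (∀ x, |g x - f x| ≤ δ) ∧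
      ∀ (x : M) (y : TangentSpace (𝓡 n) x), differential n g x y ≤ (1 + δ) * F.toFun x y := by
  choose U hUo hUx hUc hU using fun x => F.exists_local_smooth_approx hf x (half_pos hδ)
  obtain ⟨t, ht⟩ := isCompact_univ.elim_nhds_subcover U fun x _ => (hUo x).mem_nhds (hUx x)
  obtain ⟨ρ, hρ⟩ := SmoothPartitionOfUnity.exists_isSubordinate (𝓡 n) (isClosed_univ (X := M))
    (fun i : t => U i) (fun i => hUo i) (by simpa [Set.iUnion_subtype] using ht.2)
  have hρs : ∀ i, ContMDiff (𝓡 n) 𝓘(ℝ, ℝ) ∞ (ρ i) := fun i => (ρ i).contMDiff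
  have hρ1 : ∀ x, ∑ i, ρ i x = 1 := fun x => by
    rw [← finsum_eq_sum_of_fintype]
    exact ρ.sum_eq_one trivial
  choose C hC0 hC using fun i => F.exists_abs_differential_le (hρs i)
  have hCsum : 0 ≤ ∑ i, C i := Finset.sum_nonneg fun i _ => hC0 i
  -- The first bound gives the uniform error; the second makes the terms containing differentials of
  -- cutoffs cost at most `δ / 2` in total.
  set η := min δ (δ / 2 / (∑ i, C i + 1)) with hη
  have hη0 : 0 < η := by positivity
  have hηC : η * ∑ i, C i ≤ δ / 2 := by
    calc η * ∑ i, C i ≤ δ / 2 / (∑ i, C i + 1) * (∑ i, C i + 1) := by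
          gcongr
          · exact min_le_right _ _
          · linarith
      _ = δ / 2 := by field_simp
  choose g hgs hgη hgd using fun i : t => hU i η hη0
  have hsupp : ∀ (i : t) x, x ∉ U i → x ∉ tsupport (ρ i) := fun i x hx h => hx (hρ i h)
  have hzero : ∀ (i : t) x, x ∉ U i → ρ i x = 0 := fun i x hx => image_eq_zero_of_notMem_tsupport
    (hsupp i x hx)
  refine ⟨fun x => ∑ i, ρ i x * g i x, ?_, fun x => ?_, fun x y => ?_⟩
  · have := hρ.contMDiff_finsum_smul (fun i => hUo i) hgs
    simpa only [finsum_eq_sum_of_fintype, smul_eq_mul] using this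
  · have h1 : ∑ i, ρ i x * g i x - f x = ∑ i, ρ i x * (g i x - f x) := by
      simp only [mul_sub, Finset.sum_sub_distrib, ← Finset.sum_mul, hρ1, one_mul]
    rw [h1]
    calc |∑ i, ρ i x * (g i x - f x)| ≤ ∑ i, |ρ i x * (g i x - f x)| :=
          Finset.abs_sum_le_sum_abs _ _
      _ ≤ ∑ i, ρ i x * δ := by
          refine Finset.sum_le_sum fun i _ => ?_
          by_cases hx : x ∈ U i
          · rw [abs_mul, abs_of_nonneg (ρ.nonneg i x)]
            exact mul_le_mul_of_nonneg_left ((hgη i x hx).trans (min_le_left _ _)) (ρ.nonneg i x)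
          · simp [hzero i x hx]
      _ = δ := by rw [← Finset.sum_mul, hρ1, one_mul]
  · have hF := F.nonneg x y
    -- Since the cutoffs sum to `1`, subtracting the constant `f x` from every `g i` does not change
    -- the differential of the sum. Each differential of a cutoff is then multiplied by the small
    -- number `g i x - f x`.
    have hterm : ∀ i, ∃ L : TangentSpace (𝓡 n) x →L[ℝ] ℝ,
        HasMFDerivAt (𝓡 n) 𝓘(ℝ, ℝ) (fun z => ρ i z * (g i z - f x)) x L ∧
          L y ≤ ρ i x * ((1 + δ / 2) * F.toFun x y) + η * C i * F.toFun x y := by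
      intro i
      by_cases hx : x ∈ U i
      · have hgx := ((hgs i).contMDiffAt ((hUo i).mem_nhds hx)).mdifferentiableAt
          (by simp) |>.hasMFDerivAt_differential
        have hρx := ((hρs i).mdifferentiableAt (x := x) (by simp)).hasMFDerivAt_differential
        have hsub := hgx.sub (hasMFDerivAt_const (I := 𝓡 n) (I' := 𝓘(ℝ, ℝ)) (f x) x)
        refine ⟨_, hρx.mul hsub, ?_⟩
        have h1 := mul_le_mul_of_nonneg_left (hgd i x hx y) (ρ.nonneg i x)
        have h2 : (g i x - f x) * differential n (ρ i) x y ≤ η * (C i * F.toFun x y) := by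
          refine (le_abs_self _).trans ?_
          rw [abs_mul]
          exact mul_le_mul (hgη i x hx) (hC i x y) (abs_nonneg _) hη0.le
        have h3 : (ρ i x • (differential n (g i) x - 0)
            + (g i x - f x) • differential n (ρ i) x) y
            = ρ i x * differential n (g i) x y + (g i x - f x) * differential n (ρ i) x y := by
          simp
        refine (le_of_eq h3).trans ?_
        linarith
      -- Here `g i` need not be differentiable, but `x` lies off the closed support of `ρ i`, so the
      -- product vanishes near `x`.
      · refine ⟨0, ?_, ?_⟩
        · have hev : (fun z => ρ i z * (g i z - f x)) =ᶠ[𝓝 x] fun _ => 0 := by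
            have := notMem_tsupport_iff_eventuallyEq.1 (hsupp i x hx)
            filter_upwards [this] with z hz
            rw [hz]
            simp
          exact (hasMFDerivAt_const (I := 𝓡 n) (I' := 𝓘(ℝ, ℝ)) (0 : ℝ) x).congr_of_eventuallyEq hev
        · rw [hzero i x hx, zero_mul, zero_add]
          have := hC0 i
          simpa using by positivity
    choose L hL hLy using hterm
    have hsum := (HasMFDerivAt.sum_real Finset.univ fun i _ => hL i).add
      (hasMFDerivAt_const (I := 𝓡 n) (I' := 𝓘(ℝ, ℝ)) (f x) x)
    have hfun : (fun z => ∑ i, ρ i z * g i z)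
        = (fun z => ∑ i, ρ i z * (g i z - f x)) + fun _ => f x := by
      ext z
      simp only [Pi.add_apply, mul_sub, Finset.sum_sub_distrib, ← Finset.sum_mul, hρ1, one_mul]
      ring
    rw [hfun, hsum.differential_eq]
    have h3 : ((∑ i, L i) + (0 : TangentSpace (𝓡 n) x →L[ℝ] ℝ)) y = ∑ i, L i y := by
      simp
    refine (le_of_eq h3).trans ?_
    calc ∑ i, L i y ≤ ∑ i, (ρ i x * ((1 + δ / 2) * F.toFun x y) + η * C i * F.toFun x y) :=
          Finset.sum_le_sum fun i _ => hLy i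
      _ = (1 + δ / 2) * F.toFun x y + (η * ∑ i, C i) * F.toFun x y := by
          rw [Finset.sum_add_distrib, ← Finset.sum_mul, hρ1, one_mul, ← Finset.sum_mul,
            Finset.mul_sum]
      _ ≤ (1 + δ) * F.toFun x y := by nlinarith

end Approximation

end FinslerMetric

/-! ### Truncations and their variance -/

/-- A smooth nondecreasing cutoff with slope at most `1`, constant outside `(r, r + s)`, whose
total increase is as close to `s` as desired. -/
lemma exists_smooth_clamp (r : ℝ) {s τ : ℝ} (hτ : 0 < τ) (hτs : τ < s) :
    ∃ (φ : ℝ → ℝ) (T : ℝ), ContDiff ℝ ∞ φ ∧ τ ≤ T ∧ (∀ t ≤ r, φ t = 0) ∧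
      (∀ t, r + s ≤ t → φ t = T) ∧ (∀ t, 0 ≤ deriv φ t) ∧ (∀ t, deriv φ t ≤ 1) ∧
      ∀ t, t ∉ Set.Ioo r (r + s) → deriv φ t = 0 := by
  -- The cutoff is the primitive of this bump, which equals `1` on a central interval of length `τ`
  -- and vanishes outside one of length `s`.
  let b : ContDiffBump (r + s / 2) := ⟨τ / 2, s / 2, by positivity, by linarith⟩
  have hb0 : ∀ t, t ∉ Set.Ioo r (r + s) → b t = 0 := fun t ht => by
    refine b.zero_of_le_dist ?_
    by_contra h
    have h := not_le.1 h
    have hr : b.rOut = s / 2 := rfl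
    rw [Real.dist_eq, abs_lt, hr] at h
    exact ht ⟨by linarith [h.1], by linarith [h.2]⟩
  have hbc : Continuous b := b.continuous
  have hd : ∀ t, HasDerivAt (fun t => ∫ x in r..t, b x) (b t) t := fun t =>
    intervalIntegral.integral_hasDerivAt_right (hbc.intervalIntegrable _ _)
      (hbc.stronglyMeasurableAtFilter _ _) hbc.continuousAt
  have hderiv : deriv (fun t => ∫ x in r..t, b x) = b := funext fun t => (hd t).deriv
  refine ⟨fun t => ∫ x in r..t, b x, ∫ x in r..(r + s), b x, ?_, ?_, ?_, ?_, ?_, ?_, ?_⟩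
  · rw [contDiff_infty_iff_deriv, hderiv]
    exact ⟨fun t => (hd t).differentiableAt, b.contDiff⟩
  · calc τ = ∫ x in (r + s / 2 - τ / 2)..(r + s / 2 + τ / 2), (1 : ℝ) := by simp
      _ = ∫ x in (r + s / 2 - τ / 2)..(r + s / 2 + τ / 2), b x := by
          refine intervalIntegral.integral_congr fun x hx => (b.one_of_mem_closedBall ?_).symm
          rw [Set.uIcc_of_le (by linarith)] at hx
          rw [Real.closedBall_eq_Icc]
          exact hx
      _ ≤ ∫ x in r..(r + s), b x :=
          intervalIntegral.integral_mono_interval (by linarith) (by linarith) (by linarith)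
            (Eventually.of_forall fun x => b.nonneg) (hbc.intervalIntegrable _ _)
  · intro t ht
    refine (intervalIntegral.integral_congr (g := fun _ => (0 : ℝ)) fun x hx => ?_).trans (by simp)
    rw [Set.uIcc_of_ge ht] at hx
    exact hb0 x fun h => absurd h.1 (not_lt.2 hx.2)
  · intro t ht
    have h0 : ∫ x in (r + s)..t, b x = 0 := by
      refine (intervalIntegral.integral_congr (g := fun _ => (0 : ℝ)) fun x hx => ?_).trans
        (by simp)
      rw [Set.uIcc_of_le ht] at hx
      exact hb0 x fun h => absurd h.2 (not_lt.2 hx.1)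
    have := intervalIntegral.integral_add_adjacent_intervals (μ := volume)
      (hbc.intervalIntegrable r (r + s)) (hbc.intervalIntegrable (r + s) t)
    rw [h0, add_zero] at this
    exact this.symm
  · rw [hderiv]
    exact fun t => b.nonneg
  · rw [hderiv]
    exact fun t => b.le_one
  · rw [hderiv]
    exact hb0

/-- A function taking two values on sets of measures `p` and `q` has variance at least
`T² p q / (p + q)`, where `T` is the difference of the values. -/
lemma le_iInf_lintegral_sq_sub {X : Type*} [MeasurableSpace X] {μ : Measure X} [IsFiniteMeasure μ]
    {u : X → ℝ} {T : ℝ} {A B : Set X} (hA : MeasurableSet A) (hB : MeasurableSet B)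
    (hAB : Disjoint A B) (huA : ∀ x ∈ A, u x = 0) (huB : ∀ x ∈ B, u x = T)
    (hpos : 0 < μ.real A + μ.real B) :
    ENNReal.ofReal (T ^ 2 * (μ.real A * μ.real B) / (μ.real A + μ.real B)) ≤
      ⨅ c : ℝ, ∫⁻ x, ENNReal.ofReal (|u x - c| ^ 2) ∂μ := by
  refine le_iInf fun c => ?_
  have hconst : ∀ (S : Set X) (v : ℝ), MeasurableSet S → (∀ x ∈ S, u x = v) →
      ∫⁻ x in S, ENNReal.ofReal (|u x - c| ^ 2) ∂μ = ENNReal.ofReal ((v - c) ^ 2 * μ.real S) := by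
    intro S v hS h
    rw [setLIntegral_congr_fun hS (g := fun _ => ENNReal.ofReal ((v - c) ^ 2))
      (fun x hx => by simp only [h x hx, sq_abs]), setLIntegral_const,
      ENNReal.ofReal_mul (sq_nonneg _), ofReal_measureReal]
  calc ENNReal.ofReal (T ^ 2 * (μ.real A * μ.real B) / (μ.real A + μ.real B))
      ≤ ENNReal.ofReal ((0 - c) ^ 2 * μ.real A + (T - c) ^ 2 * μ.real B) := by
        refine ENNReal.ofReal_le_ofReal ?_
        rw [div_le_iff₀ hpos]
        -- With `p`, `q` the two masses, `(c² p + (T - c)² q) (p + q) - T² p q` is exactly the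
        -- square `(c p - (T - c) q)²`.
        nlinarith [sq_nonneg (c * μ.real A - (T - c) * μ.real B)]
    _ = ∫⁻ x in A ∪ B, ENNReal.ofReal (|u x - c| ^ 2) ∂μ := by
        rw [lintegral_union hB hAB, hconst A 0 hA huA, hconst B T hB huB,
          ENNReal.ofReal_add (by positivity) (by positivity)]
    _ ≤ ∫⁻ x, ENNReal.ofReal (|u x - c| ^ 2) ∂μ := setLIntegral_le_lintegral _ _

namespace FinslerMetric

/-! ### Poincaré's inequality for level sets -/

section Poincare

variable {n : ℕ} {M : Type*} [TopologicalSpace M]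
  [ChartedSpace (EuclideanSpace ℝ (Fin n)) M] [IsManifold (𝓡 n) ∞ M]

lemma dual_le (F : FinslerMetric n M) {x : M} {ξ : TangentSpace (𝓡 n) x →L[ℝ] ℝ} {L : ℝ}
    (h : ∀ y, ξ y ≤ L * F.toFun x y) : F.dual x ξ ≤ ENNReal.ofReal L :=
  iSup₂_le fun y hy => ENNReal.ofReal_le_ofReal ((div_le_iff₀ (F.pos x hy)).2 (h y))

variable [MeasurableSpace M]

/-- The differential of the composite is `φ'(g) dg`. Since `φ' ≥ 0`, the one-sided bound on `dg`
survives multiplication; since `φ' ≤ 1` vanishes off `J`, only `g ⁻¹' J` contributes, with density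
at most `L²`. -/
lemma energy_comp_le [OpensMeasurableSpace M] (F : FinslerMetric n M) (m : Measure M)
    {g : M → ℝ} (hg : ContMDiff (𝓡 n) 𝓘(ℝ, ℝ) ∞ g) {L : ℝ} (hL : 0 ≤ L)
    (hgL : ∀ (x : M) (y : TangentSpace (𝓡 n) x), differential n g x y ≤ L * F.toFun x y)
    {φ : ℝ → ℝ} (hφ : ContDiff ℝ ∞ φ) (h0 : ∀ t, 0 ≤ deriv φ t) (h1 : ∀ t, deriv φ t ≤ 1)
    {J : Set ℝ} (hJ : MeasurableSet J) (hφJ : ∀ t, t ∉ J → deriv φ t = 0) :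
    F.energy m (φ ∘ g) ≤ ENNReal.ofReal (L ^ 2) * m (g ⁻¹' J) := by
  have hmeas : MeasurableSet (g ⁻¹' J) := hg.continuous.measurable hJ
  have hdual : ∀ x, F.dual x (differential n (φ ∘ g) x) ≤ ENNReal.ofReal (deriv φ (g x) * L) := by
    intro x
    refine F.dual_le fun y => ?_
    rw [differential_comp_real (hφ.differentiable (by simp) _) (hg.mdifferentiableAt (by simp))]
    have := mul_le_mul_of_nonneg_left (hgL x y) (h0 (g x))
    rw [mul_assoc]
    exact this
  calc F.energy m (φ ∘ g) ≤ ∫⁻ x, (g ⁻¹' J).indicator (fun _ => ENNReal.ofReal (L ^ 2)) x ∂m := by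
        refine lintegral_mono fun x => ?_
        refine (pow_le_pow_left' (hdual x) 2).trans ?_
        by_cases hx : g x ∈ J
        · rw [Set.indicator_of_mem (show x ∈ g ⁻¹' J from hx),
            ← ENNReal.ofReal_pow (mul_nonneg (h0 _) hL)]
          refine ENNReal.ofReal_le_ofReal (pow_le_pow_left₀ (mul_nonneg (h0 _) hL) ?_ 2)
          exact mul_le_of_le_one_left hL (h1 _)
        · simp [hφJ _ hx]
    _ = ENNReal.ofReal (L ^ 2) * m (g ⁻¹' J) := lintegral_indicator_const hmeas _

/-- Poincaré's inequality, applied to truncations of an almost Lipschitz function: the measures of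
a sublevel set and of a superlevel set at distance `s`. -/
lemma firstEigenvalue_mul_measure_le [OpensMeasurableSpace M] (F : FinslerMetric n M)
    (m : Measure M) [IsProbabilityMeasure m] {g : M → ℝ} (hg : ContMDiff (𝓡 n) 𝓘(ℝ, ℝ) ∞ g)
    {L l : ℝ} (hL : 0 ≤ L) (hl : 0 < l) (hlF : ENNReal.ofReal l ≤ F.firstEigenvalue m)
    (hgL : ∀ (x : M) (y : TangentSpace (𝓡 n) x), differential n g x y ≤ L * F.toFun x y)
    (r : ℝ) {s : ℝ} (hs : 0 < s) :
    l * s ^ 2 * (m.real {x | g x ≤ r} * m.real {x | r + s ≤ g x}) ≤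
      L ^ 2 * (1 - m.real {x | g x ≤ r} - m.real {x | r + s ≤ g x}) *
        (m.real {x | g x ≤ r} + m.real {x | r + s ≤ g x}) := by
  have hgm : Measurable g := hg.continuous.measurable
  set A := {x | g x ≤ r}
  set B := {x | r + s ≤ g x}
  have hA : MeasurableSet A := hgm measurableSet_Iic
  have hB : MeasurableSet B := hgm measurableSet_Ici
  have hAB : Disjoint A B := Set.disjoint_left.2 fun x (h1 : g x ≤ r) (h2 : r + s ≤ g x) => by
    linarith
  set J := g ⁻¹' Set.Ioo r (r + s)
  have hJ : m.real J = 1 - m.real A - m.real B := by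
    have hcompl : J = (A ∪ B)ᶜ := by
      ext x
      simp [J, A, B]
    rw [hcompl, probReal_compl_eq_one_sub (hA.union hB), measureReal_union hAB hB]
    ring
  rw [← hJ]
  have hp := measureReal_nonneg (μ := m) (s := A)
  have hq := measureReal_nonneg (μ := m) (s := B)
  have hj := measureReal_nonneg (μ := m) (s := J)
  -- If either set is null the left side vanishes; otherwise both are nonempty, so the truncation is
  -- not constant and may be used as a test function.
  rcases hp.eq_or_lt with hp0 | hp0
  · rw [← hp0]; simp; positivity
  rcases hq.eq_or_lt with hq0 | hq0
  · rw [← hq0]; simp; positivity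
  -- A smooth clamp of slope at most `1` cannot rise by the full `s`, so `s` is reached as a limit.
  have key : ∀ τ, 0 < τ → τ < s →
      l * τ ^ 2 * (m.real A * m.real B) ≤ L ^ 2 * m.real J * (m.real A + m.real B) := by
    intro τ hτ hτs
    obtain ⟨φ, T, hφ, hT, hφ0, hφT, hd0, hd1, hdJ⟩ := exists_smooth_clamp r hτ hτs
    have hu : ContMDiff (𝓡 n) 𝓘(ℝ, ℝ) ∞ (φ ∘ g) := hφ.contMDiff.comp hg
    have hne : ¬ ∃ c : ℝ, ∀ x, (φ ∘ g) x = c := by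
      rintro ⟨c, hc⟩
      obtain ⟨a, ha⟩ : A.Nonempty := Set.nonempty_iff_ne_empty.2 fun h => by simp [h] at hp0
      obtain ⟨b, hb⟩ : B.Nonempty := Set.nonempty_iff_ne_empty.2 fun h => by simp [h] at hq0
      have h1 : φ (g a) = 0 := hφ0 _ ha
      have h2 : φ (g b) = T := hφT _ hb
      have h3 : φ (g a) = φ (g b) := (hc a).trans (hc b).symm
      linarith
    have h1 : ENNReal.ofReal l ≤ F.energy m (φ ∘ g) /
        ⨅ c : ℝ, ∫⁻ x, ENNReal.ofReal (|(φ ∘ g) x - c| ^ 2) ∂m :=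
      hlF.trans (iInf_le_of_le _ (iInf₂_le_of_le hu hne le_rfl))
    have h2 := ENNReal.mul_le_of_le_div h1
    have h3 := le_iInf_lintegral_sq_sub (μ := m) (u := φ ∘ g) (T := T) hA hB hAB
      (fun x hx => hφ0 _ hx) (fun x hx => hφT _ hx) (by positivity)
    have h4 := F.energy_comp_le m hg hL hgL hφ hd0 hd1 measurableSet_Ioo hdJ
    have h5 := (mul_le_mul_right h3 (ENNReal.ofReal l)).trans (h2.trans h4)
    rw [← ENNReal.ofReal_mul hl.le, ← ofReal_measureReal,
      ← ENNReal.ofReal_mul (sq_nonneg L),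
      ENNReal.ofReal_le_ofReal_iff (mul_nonneg (sq_nonneg L) measureReal_nonneg), mul_div_assoc',
      div_le_iff₀ (by positivity)] at h5
    refine le_trans ?_ h5
    rw [mul_assoc]
    gcongr
  refine le_of_tendsto (f := fun τ => l * τ ^ 2 * (m.real A * m.real B)) (x := 𝓝[<] s) ?_ ?_
  · have : Continuous fun τ => l * τ ^ 2 * (m.real A * m.real B) := by fun_prop
    exact (this.tendsto s).mono_left nhdsWithin_le_nhds
  · filter_upwards [Ioo_mem_nhdsLT hs] with τ hτ
    exact key τ hτ.1 hτ.2

end Poincare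

end FinslerMetric

/-! ### Exponential concentration around a median -/

section Concentration

variable {X : Type*} [MeasurableSpace X] {μ : Measure X} [IsProbabilityMeasure μ] {g : X → ℝ}

/-- Existence of a median of a probability measure on the line. -/
lemma exists_median (ν : Measure ℝ) [IsProbabilityMeasure ν] :
    ∃ a : ℝ, 1 / 2 ≤ ν.real (Set.Iic a) ∧ 1 / 2 ≤ ν.real (Set.Ici a) := by
  set S := {t : ℝ | 1 / 2 ≤ ν.real (Set.Iic t)}
  have hcdf : ∀ t, ProbabilityTheory.cdf ν t = ν.real (Set.Iic t) :=
    ProbabilityTheory.cdf_eq_real ν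
  have hne : S.Nonempty := by
    obtain ⟨t, ht⟩ := ((ProbabilityTheory.tendsto_cdf_atTop ν).eventually
      (lt_mem_nhds one_half_lt_one)).exists
    exact ⟨t, by simpa only [S, Set.mem_ofPred_eq, ← hcdf] using ht.le⟩
  have hbdd : BddBelow S := by
    obtain ⟨t, ht⟩ := ((ProbabilityTheory.tendsto_cdf_atBot ν).eventually
      (gt_mem_nhds one_half_pos)).exists
    refine ⟨t, fun z hz => ?_⟩
    by_contra h
    have h1 : 1 / 2 ≤ ν.real (Set.Iic z) := hz
    have h2 := ProbabilityTheory.monotone_cdf ν (not_le.1 h).le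
    rw [hcdf z] at h2
    linarith
  refine ⟨sInf S, ?_, ?_⟩
  · rw [← hcdf]
    have hrc := (ProbabilityTheory.cdf ν).right_continuous (sInf S)
    refine ge_of_tendsto (hrc.tendsto.mono_left (nhdsWithin_mono _ Set.Ioi_subset_Ici_self)) ?_
    filter_upwards [self_mem_nhdsWithin] with t ht
    obtain ⟨z, hz, hzt⟩ := exists_lt_of_csInf_lt hne ht
    have h1 : 1 / 2 ≤ ν.real (Set.Iic z) := hz
    rw [← hcdf] at h1
    exact h1.trans (ProbabilityTheory.monotone_cdf ν hzt.le)
  -- The open half-line is exhausted by closed ones ending below the infimum, each of mass less than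
  -- `1 / 2`.
  · have hlim : ν.real (Set.Iio (sInf S)) ≤ 1 / 2 := by
      have h1 : ν (Set.Iio (sInf S)) ≤ ENNReal.ofReal (1 / 2) := by
        obtain ⟨u, hu, hul, hut⟩ := exists_seq_strictMono_tendsto (sInf S)
        have hU : Set.Iio (sInf S) = ⋃ k, Set.Iic (u k) := by
          ext z
          simp only [Set.mem_Iio, Set.mem_iUnion, Set.mem_Iic]
          exact ⟨fun hz => (hut.eventually (lt_mem_nhds hz)).exists.imp fun _ h => h.le,
            fun ⟨k, hk⟩ => hk.trans_lt (hul k)⟩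
        rw [hU, Monotone.measure_iUnion fun i j hij => Set.Iic_subset_Iic.2 (hu.monotone hij)]
        refine iSup_le fun k => ?_
        rw [← ofReal_measureReal]
        refine ENNReal.ofReal_le_ofReal (le_of_lt ?_)
        by_contra h
        exact absurd (csInf_le hbdd (show u k ∈ S from not_lt.1 h)) (not_le.2 (hul k))
      exact ENNReal.toReal_le_of_le_ofReal (by norm_num) h1
    have := probReal_compl_eq_one_sub (μ := ν) (measurableSet_Iio (a := sInf S))
    rw [Set.compl_Iio] at this
    linarith

/-- If the mass between any two level sets at distance `s` controls the masses outside as in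
Poincaré's inequality, the distribution concentrates exponentially around a median. -/
lemma exists_concentration_interval (hg : Measurable g) {s : ℝ} (hs : 0 < s)
    (H : ∀ r, 2 * (μ.real {x | g x ≤ r} * μ.real {x | r + s ≤ g x}) ≤
      (1 - μ.real {x | g x ≤ r} - μ.real {x | r + s ≤ g x}) *
        (μ.real {x | g x ≤ r} + μ.real {x | r + s ≤ g x})) :
    ∃ a : ℝ, ∀ k : ℕ, 1 - (1 / 2) ^ k ≤ μ.real {x | a - k * s ≤ g x ∧ g x ≤ a + k * s} := by
  have : IsProbabilityMeasure (μ.map g) := Measure.isProbabilityMeasure_map hg.aemeasurable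
  obtain ⟨a, ha1, ha2⟩ := exists_median (μ.map g)
  rw [map_measureReal_apply hg measurableSet_Iic] at ha1
  rw [map_measureReal_apply hg measurableSet_Ici] at ha2
  have hlt : ∀ r, μ.real {x | r < g x} = 1 - μ.real {x | g x ≤ r} := fun r => by
    have hm : MeasurableSet {x | g x ≤ r} := hg measurableSet_Iic
    rw [← probReal_compl_eq_one_sub hm]
    congr 1
    ext x
    simp
  have hgt : ∀ r, μ.real {x | g x < r} = 1 - μ.real {x | r ≤ g x} := fun r => by
    have hm : MeasurableSet {x | r ≤ g x} := hg measurableSet_Ici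
    rw [← probReal_compl_eq_one_sub hm]
    congr 1
    ext x
    simp
  have hdisj : ∀ r, μ.real {x | g x ≤ r} + μ.real {x | r + s ≤ g x} ≤ 1 := fun r => by
    have := measureReal_mono (μ := μ) (s₁ := {x | r + s ≤ g x}) (s₂ := {x | r < g x})
      (fun x (hx : r + s ≤ g x) => show r < g x by linarith)
    rw [hlt] at this
    linarith
  have hup : ∀ k : ℕ, μ.real {x | a + k * s < g x} ≤ (1 / 2) ^ k / 2 := by
    intro k
    induction k with
    | zero =>
      have h1 : μ.real {x | g x ≤ a} = μ.real (g ⁻¹' Set.Iic a) := rfl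
      simp only [CharP.cast_eq_zero, zero_mul, add_zero, pow_zero]
      rw [hlt, h1]
      linarith
    | succ k ih =>
      have hk : (0 : ℝ) ≤ k * s := by positivity
      have hp : 1 / 2 ≤ μ.real {x | g x ≤ a + k * s} := ha1.trans <| measureReal_mono
        fun x (hx : g x ≤ a) => show g x ≤ a + k * s by linarith
      have hsub : μ.real {x | a + (k + 1 : ℕ) * s < g x} ≤ μ.real {x | a + k * s + s ≤ g x} :=
        measureReal_mono fun x (hx : a + (k + 1 : ℕ) * s < g x) => by
          push_cast at hx
          show a + k * s + s ≤ g x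
          linarith
      have hH := H (a + k * s)
      have hd := hdisj (a + k * s)
      rw [hlt] at ih
      have hq := measureReal_nonneg (μ := μ) (s := {x | a + k * s + s ≤ g x})
      set p := μ.real {x | g x ≤ a + k * s}
      set q := μ.real {x | a + k * s + s ≤ g x}
      -- As `p ≥ 1/2` and `p + q ≤ 1`, one has `q ≤ p`, so `q (p + q) ≤ 2 p q`. Cancelling `p + q`
      -- leaves `2 q ≤ 1 - p`: the tail is halved.
      have h2 : q * (p + q) ≤ (1 - p - q) * (p + q) := by nlinarith
      have h3 := le_of_mul_le_mul_right h2 (by linarith)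
      rw [pow_succ]
      linarith
  have hlow : ∀ k : ℕ, μ.real {x | g x < a - k * s} ≤ (1 / 2) ^ k / 2 := by
    intro k
    induction k with
    | zero =>
      have h1 : μ.real {x | a ≤ g x} = μ.real (g ⁻¹' Set.Ici a) := rfl
      simp only [CharP.cast_eq_zero, zero_mul, sub_zero, pow_zero]
      rw [hgt, h1]
      linarith
    | succ k ih =>
      have hk : (0 : ℝ) ≤ k * s := by positivity
      -- The mirror image: the upper level is now `a - k s`, above which at least half of the mass
      -- lies, and the lower tail is halved.
      have hH := H (a - k * s - s)
      have hd := hdisj (a - k * s - s)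
      rw [sub_add_cancel] at hH hd
      have hq : 1 / 2 ≤ μ.real {x | a - k * s ≤ g x} := ha2.trans <| measureReal_mono
        fun x (hx : a ≤ g x) => show a - k * s ≤ g x by linarith
      have hsub : μ.real {x | g x < a - (k + 1 : ℕ) * s} ≤ μ.real {x | g x ≤ a - k * s - s} :=
        measureReal_mono fun x (hx : g x < a - (k + 1 : ℕ) * s) => by
          push_cast at hx
          show g x ≤ a - k * s - s
          linarith
      rw [hgt] at ih
      have hp := measureReal_nonneg (μ := μ) (s := {x | g x ≤ a - k * s - s})
      set p := μ.real {x | g x ≤ a - k * s - s}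
      set q := μ.real {x | a - k * s ≤ g x}
      have h2 : p * (p + q) ≤ (1 - p - q) * (p + q) := by nlinarith
      have h3 := le_of_mul_le_mul_right h2 (by linarith)
      rw [pow_succ]
      linarith
  refine ⟨a, fun k => ?_⟩
  have hm : MeasurableSet {x | a - k * s ≤ g x ∧ g x ≤ a + k * s} := hg measurableSet_Icc
  have hcompl := probReal_compl_eq_one_sub (μ := μ) hm
  have hunion : μ.real {x | a - k * s ≤ g x ∧ g x ≤ a + k * s}ᶜ ≤
      μ.real {x | g x < a - k * s} + μ.real {x | a + k * s < g x} := by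
    refine (measureReal_mono fun x hx => ?_).trans (measureReal_union_le _ _)
    by_contra h
    simp only [Set.mem_union, Set.mem_ofPred_eq, not_or, not_lt] at h
    exact hx h
  linarith [hup k, hlow k]

lemma parDiam_map_le_of_interval {f : X → ℝ} (hf : Measurable f) {a b ε : ℝ}
    (h : 1 - ε ≤ μ.real {x | a ≤ f x ∧ f x ≤ b}) :
    parDiam (fun s t : ℝ => ENNReal.ofReal |s - t|) (μ.map f) ε ≤ ENNReal.ofReal (b - a) := by
  have hA : ENNReal.ofReal (1 - ε) ≤ μ.map f (Set.Icc a b) := by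
    rw [Measure.map_apply hf measurableSet_Icc, ← ofReal_measureReal]
    exact ENNReal.ofReal_le_ofReal h
  refine (iInf₂_le_of_le (Set.Icc a b) measurableSet_Icc (iInf_le _ hA)).trans ?_
  refine iSup₂_le fun x hx => iSup₂_le fun z hz => ENNReal.ofReal_le_ofReal ?_
  rw [abs_sub_le_iff]
  constructor <;> linarith [hx.1, hx.2, hz.1, hz.2]

end Concentration

/-- Take `k = ⌈log₂ (1 / ε)⌉`; rounding up adds at most `1`, which is the factor `2` in `log (2 /
ε)`. -/
lemma exists_nat_half_pow_le {ε : ℝ} (hε0 : 0 < ε) (hε1 : ε < 1) :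
    ∃ k : ℕ, (1 / 2 : ℝ) ^ k ≤ ε ∧ k * Real.log 2 ≤ Real.log (2 / ε) := by
  have hlog2 : 0 < Real.log 2 := Real.log_pos one_lt_two
  have hlogε : Real.log ε < 0 := Real.log_neg hε0 hε1
  refine ⟨⌈-Real.log ε / Real.log 2⌉₊, ?_, ?_⟩
  · rw [← Real.log_le_log_iff (by positivity) hε0, Real.log_pow, one_div, Real.log_inv]
    have := Nat.le_ceil (-Real.log ε / Real.log 2)
    rw [div_le_iff₀ hlog2] at this
    linarith
  · have := (Nat.ceil_lt_add_one (a := -Real.log ε / Real.log 2)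
      (div_nonneg (by linarith) hlog2.le)).le
    have h2 := mul_le_mul_of_nonneg_right this hlog2.le
    rw [add_mul, div_mul_cancel₀ _ hlog2.ne'] at h2
    rw [Real.log_div two_ne_zero hε0.ne']
    linarith

namespace FinslerMetric

/-! ### The observable diameter estimate -/

section ObservableDiameter

variable {n : ℕ} {M : Type*} [TopologicalSpace M] [T2Space M] [CompactSpace M]
  [ChartedSpace (EuclideanSpace ℝ (Fin n)) M] [IsManifold (𝓡 n) ∞ M]
  [MeasurableSpace M] [BorelSpace M]

/-- Stated for every real `l` below the eigenvalue rather than the eigenvalue itself, so that an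
infinite eigenvalue can be treated by letting `l` grow. -/
lemma parDiam_le_of_le_firstEigenvalue (F : FinslerMetric n M) (m : Measure M)
    [IsProbabilityMeasure m] {f : M → ℝ} (hf : IsLipschitzOne F.dist f) {l : ℝ} (hl : 0 < l)
    (hlF : ENNReal.ofReal l ≤ F.firstEigenvalue m) {ε : ℝ} (hε0 : 0 < ε) (hε1 : ε < 1) :
    parDiam (fun s t : ℝ => ENNReal.ofReal |s - t|) (m.map f) ε ≤
      ENNReal.ofReal (2 * √2 / Real.log 2 * Real.log (2 / ε) / √l) := by
  obtain ⟨k, hkε, hk⟩ := exists_nat_half_pow_le hε0 hε1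
  have hfm : Measurable f := (F.continuous_of_isLipschitzOne hf).measurable
  -- Chosen so that `l σ² = 2`. With step `(1 + δ) σ` and Lipschitz bound `1 + δ`, the factors `(1 +
  -- δ)²` cancel and exactly the concentration hypothesis remains.
  set σ := √2 / √l with hσ
  have hσ0 : 0 < σ := by positivity
  have hσl : l * σ ^ 2 = 2 := by
    rw [hσ, div_pow, Real.sq_sqrt hl.le, Real.sq_sqrt two_pos.le]
    field_simp
  -- The term `2 * δ` pays for replacing `g` by `f` at both ends of the interval. The number `k`
  -- does not depend on `δ`, so `δ → 0` is harmless.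
  have key : ∀ δ : ℝ, 0 < δ →
      parDiam (fun s t : ℝ => ENNReal.ofReal |s - t|) (m.map f) ε ≤
        ENNReal.ofReal (2 * (k * ((1 + δ) * σ)) + 2 * δ) := by
    intro δ hδ
    obtain ⟨g, hg, hgf, hgL⟩ := F.exists_smooth_approx hf hδ
    have hs : 0 < (1 + δ) * σ := by positivity
    obtain ⟨a, ha⟩ := exists_concentration_interval (μ := m) hg.continuous.measurable hs
      fun r => by
        have h := F.firstEigenvalue_mul_measure_le m hg (by positivity : 0 ≤ 1 + δ) hl hlF hgL r hs
        rw [mul_pow, mul_left_comm l, hσl, mul_assoc, mul_assoc] at h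
        exact le_of_mul_le_mul_left h (by positivity)
    have hsub : m.real {x | a - k * ((1 + δ) * σ) ≤ g x ∧ g x ≤ a + k * ((1 + δ) * σ)} ≤
        m.real {x | a - k * ((1 + δ) * σ) - δ ≤ f x ∧ f x ≤ a + k * ((1 + δ) * σ) + δ} := by
      refine measureReal_mono fun x hx => ?_
      have h1 := abs_le.1 (hgf x)
      exact ⟨by linarith [hx.1, h1.2], by linarith [hx.2, h1.1]⟩
    refine (parDiam_map_le_of_interval hfm ((by linarith [ha k] : 1 - ε ≤ _).trans hsub)).trans ?_
    exact ENNReal.ofReal_le_ofReal (by linarith)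
  have hlim : Tendsto (fun δ : ℝ => ENNReal.ofReal (2 * (k * ((1 + δ) * σ)) + 2 * δ)) (𝓝[>] 0)
      (𝓝 (ENNReal.ofReal (2 * (k * ((1 + 0) * σ)) + 2 * 0))) := by
    have : Continuous fun δ : ℝ => ENNReal.ofReal (2 * (k * ((1 + δ) * σ)) + 2 * δ) :=
      ENNReal.continuous_ofReal.comp (by fun_prop)
    exact (this.tendsto 0).mono_left nhdsWithin_le_nhds
  refine (ge_of_tendsto hlim (by filter_upwards [self_mem_nhdsWithin] with δ hδ using key δ hδ)).trans
    (ENNReal.ofReal_le_ofReal ?_)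
  have hlog2 : 0 < Real.log 2 := Real.log_pos one_lt_two
  have hk' : (k : ℝ) ≤ Real.log (2 / ε) / Real.log 2 := (le_div_iff₀ hlog2).2 hk
  calc 2 * (k * ((1 + 0) * σ)) + 2 * 0 = 2 * σ * k := by ring
    _ ≤ 2 * σ * (Real.log (2 / ε) / Real.log 2) := by gcongr
    _ = 2 * √2 / Real.log 2 * Real.log (2 / ε) / √l := by rw [hσ]; ring

end ObservableDiameter

end FinslerMetric

end

theorem corollary6p2 {n : ℕ} {M : Type*} [TopologicalSpace M] [T2Space M] [CompactSpace M]
    [ConnectedSpace M] [ChartedSpace (EuclideanSpace ℝ (Fin n)) M] [IsManifold (𝓡 n) ∞ M]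
    [MeasurableSpace M] [BorelSpace M]
    (F : FinslerMetric n M) (m : Measure M) (hm : IsPositiveSmoothMeasure n m)
    (hm1 : m Set.univ = 1) (ε : ℝ) (hε0 : 0 < ε) (hε1 : ε < 1) :
    obsDiam F.dist m ε ≤
      ENNReal.ofReal (2 * Real.sqrt 2 / Real.log 2 * Real.log (2 / ε)) /
        F.firstEigenvalue m ^ (1 / 2 : ℝ) := by
  have : IsProbabilityMeasure m := ⟨hm1⟩
  refine iSup₂_le fun f hf => ?_
  set K := 2 * Real.sqrt 2 / Real.log 2 * Real.log (2 / ε) with hK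
  have hK0 : 0 < K := by
    have h1 : 0 < Real.log 2 := Real.log_pos one_lt_two
    have h2 : 0 < Real.log (2 / ε) := Real.log_pos (by rw [lt_div_iff₀ hε0]; linarith)
    positivity
  have key := fun (l : ℝ) (hl : 0 < l) (hlF : ENNReal.ofReal l ≤ F.firstEigenvalue m) =>
    F.parDiam_le_of_le_firstEigenvalue m hf hl hlF hε0 hε1
  rw [← hK] at key
  -- For an infinite eigenvalue every `l > 0` is admissible and the bound tends to `0`; for a zero
  -- eigenvalue the right side is `⊤` because `K > 0`.
  rcases eq_or_ne (F.firstEigenvalue m) ⊤ with htop | htop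
  · rw [htop, ENNReal.top_rpow_of_pos (by norm_num), ENNReal.div_top]
    have hlim : Filter.Tendsto (fun l : ℝ => ENNReal.ofReal (K / √l)) Filter.atTop (nhds 0) := by
      rw [← ENNReal.ofReal_zero]
      exact ENNReal.tendsto_ofReal (Real.tendsto_sqrt_atTop.const_div_atTop K)
    refine ge_of_tendsto hlim ?_
    filter_upwards [Filter.eventually_gt_atTop 0] with l hl
    exact key l hl (by simp [htop])
  rcases eq_or_ne (F.firstEigenvalue m) 0 with h0 | h0
  · rw [h0, ENNReal.zero_rpow_of_pos (by norm_num), ENNReal.div_zero (by simpa using hK0)]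
    exact le_top
  · have hl := ENNReal.toReal_pos h0 htop
    refine (key _ hl (ENNReal.ofReal_toReal htop).le).trans (le_of_eq ?_)
    rw [ENNReal.ofReal_div_of_pos (Real.sqrt_pos.2 hl), Real.sqrt_eq_rpow,
      ← ENNReal.ofReal_rpow_of_pos hl, ENNReal.ofReal_toReal htop]
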